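/- Let $K$ be a field. For a finite simple graph $G$ on a vertex set $V$ with $|V|=n$, let $J_G$ be its binomial edge ideal in $S_G=K[x_i,y_i : i\in V]$, generated by $x_iy_j-x_jy_i$ for all edges $\{i,j\}$ of $G$. For $T\subseteq V$ let $P_T(G)\subseteq S_G$ be the ideal generated by the variables $x_i,y_i$ with $i\in T$ together with the binomials $x_iy_j-x_jy_i$ for all pairs of distinct vertices $i,j$ lying in the same connected component of the induced subgraph $G_{V\setminus T}$. A vertex $v$ of a graph is a cut point if deleting $v$ yields a graph with more connected components. Let $\mathcal C(G)$ consist of $\emptyset$ and of all $T\subseteq V$ such that every $i\in T$ is a cut point of the induced subgraph $G_{(V\setminus T)\cup\{i\}}$; put $\overline{\mathcal C}(G)=\mathcal C(G)\setminus\{\emptyset\}$. For collections $\mathcal A,\mathcal B$ of sets, let $\mathcal A\circ\mathcal B=\{A\cup B: A\in\mathcal A,\ B\in\mathcal B\}$. The join $G_1*G_2$ of graphs on disjoint vertex sets $V_1,V_2$ is the graph on $V_1\cup V_2$ whose edges are those of $G_1$, those of $G_2$, and all $\{v,w\}$ with $v\in V_1$, $w\in V_2$. Let $G_1$ and $G_2$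 be connected finite simple graphs on disjoint vertex sets $[n_1]$ and $[n_2]$ with $n_1,n_2\ge 1$ elements, respectively, and let $S=S_{G_1*G_2}$, $S_1=S_{G_1}$, $S_2=S_{G_2}$. Then (a) $\mathcal C(G_1*G_2)=\{\emptyset\}\cup\big(\overline{\mathcal C}(G_1)\circ\{[n_2]\}\big)\cup\big(\overline{\mathcal C}(G_2)\circ\{[n_1]\}\big)$; (b) $\operatorname{height} J_{G_1*G_2}=\min\{\operatorname{height}P_{T_1}(G_1)+2n_2,\ \operatorname{height}P_{T_2}(G_2)+2n_1,\ n_1+n_2-1 : T_1\in\overline{\mathcal C}(G_1),\ T_2\in\overline{\mathcal C}(G_2)\}$; (c) $\dim S/J_{G_1*G_2}=\max\{\dim S_1/P_{T_1}(G_1),\ \dim S_2/P_{T_2}(G_2),\ n_1+n_2+1 : T_1\in\overline{\mathcal C}(G_1),\ T_2\in\overline{\mathcal C}(G_2)\}$. In (b) and (c), the minimum and maximum are over the set of all the listed numbers; if $\overline{\mathcal C}(G_i)$ is empty, the terms indexed by $T_i$ are absent. -/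

import Mathlib

namespace BinomialEdge

/-- The join `G₁ * G₂` of two graphs on disjoint vertex sets: all edges of `G₁`, all edges of `G₂`,
and all edges between a vertex of `G₁` and a vertex of `G₂`. -/
def join {V₁ V₂ : Type*} (G₁ : SimpleGraph V₁) (G₂ : SimpleGraph V₂) : SimpleGraph (V₁ ⊕ V₂) where
  Adj
    | Sum.inl u, Sum.inl v => G₁.Adj u v
    | Sum.inr u, Sum.inr v => G₂.Adj u v
    | Sum.inl _, Sum.inr _ => True
    | Sum.inr _, Sum.inl _ => True
  symm := ⟨by
    rintro (u | u) (v | v) h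
    · exact h.symm
    · trivial
    · trivial
    · exact h.symm⟩
  loopless := ⟨by
    rintro (u | u) h
    · exact G₁.irrefl h
    · exact G₂.irrefl h⟩

/-- A vertex `v` of a (finite) graph is a cut point if deleting it yields a graph with more
connected components. -/
def IsCutPoint {V : Type*} (G : SimpleGraph V) (v : V) : Prop :=
  Nat.card G.ConnectedComponent < Nat.card (G.induce ({v}ᶜ : Set V)).ConnectedComponent

/-- `T` has the cut point property for `G`: each `i ∈ T` is a cut point of the subgraph induced on
`([n] \ T) ∪ {i}`. -/
def HasCutPointProperty {V : Type*} (G : SimpleGraph V) (T : Set V) : Prop :=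
  ∀ i ∈ T, IsCutPoint (G.induce (Tᶜ ∪ {i})) ⟨i, Or.inr rfl⟩

/-- The collection `𝒞(G)`. -/
def cutSets {V : Type*} (G : SimpleGraph V) : Set (Set V) :=
  {∅} ∪ {T | HasCutPointProperty G T}

/-- The collection `𝒞(G) \ {∅}`. -/
def cutSetsBar {V : Type*} (G : SimpleGraph V) : Set (Set V) :=
  cutSets G \ {∅}

/-- The join `𝒜 ∘ ℬ = {A ∪ B : A ∈ 𝒜, B ∈ ℬ}` of two collections of subsets. -/
def familyJoin {V : Type*} (A B : Set (Set V)) : Set (Set V) :=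
  Set.image2 (fun a b => a ∪ b) A B

/-- The polynomial ring `K[x_i, y_i : i ∈ V]`. -/
abbrev PolyRing (K : Type*) [Field K] (V : Type*) : Type _ :=
  MvPolynomial (Fin 2 × V) K

noncomputable section

/-- The variable `x_i`. -/
def x (K : Type*) [Field K] {V : Type*} (i : V) : PolyRing K V := MvPolynomial.X (0, i)

/-- The variable `y_i`. -/
def y (K : Type*) [Field K] {V : Type*} (i : V) : PolyRing K V := MvPolynomial.X (1, i)

/-- The binomial edge ideal `J_G`, generated by `x_i y_j - x_j y_i` for the edges `{i, j}` of `G`.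
Both orientations of an edge are listed; they give the same generator up to sign. -/
def edgeIdeal (K : Type*) [Field K] {V : Type*} (G : SimpleGraph V) : Ideal (PolyRing K V) :=
  Ideal.span {f | ∃ i j : V, G.Adj i j ∧ f = x K i * y K j - x K j * y K i}

/-- The ideal `P_T(G)`, generated by the `x_i, y_i` with `i ∈ T` and the binomial edge ideals of the
complete graphs on the vertex sets of the connected components of the subgraph induced on the
complement of `T`. -/
def primeIdeal (K : Type*) [Field K] {V : Type*} (G : SimpleGraph V) (T : Set V) :
    Ideal (PolyRing K V) :=
  Ideal.span (⋃ i ∈ T, {x K i, y K i}) ⊔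
    ⨆ c : (G.induce Tᶜ).ConnectedComponent,
      edgeIdeal K (⊤ : SimpleGraph (Subtype.val '' c.supp : Set V)).spanningCoe

end

end BinomialEdge

/-! A prime over `P_T(G)` is the kernel of a configuration of planar vectors `(x_i, y_i)` over a
field, vanishing on `T` and with the vectors of each component of `G - T` on a common line. Such a
configuration specializes the generic one, so `P_T(G)` has the same radical as the kernel of the
generic configuration, which is prime. Degenerating generic configurations one step at a time (make
a line horizontal, kill a vector, merge two lines) gives a chain of primes through that kernel of
length `2n = dim S`. The kernel therefore splits the chain into its height `|T| + n - c(T)` and its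
coheight `n - |T| + c(T)`, where `c(T)` is the number of components of `G - T`.

A prime over `J_G` contains `P_T(G)` for `T` the set of `i` with `x_i` and `y_i` in the prime.
Dropping from `T` a vertex that is not a cut point does not decrease `c(T)`, hence does not increase
the height nor decrease the dimension, so only `T ∈ 𝒞(G)` matter. In a join, `G₁ * G₂ - T` is
connected unless `T` contains a whole side, which leaves the sets `T₁ ∪ V₂`, `V₁ ∪ T₂` and `∅`.
-/

namespace BinomialEdge

section Chains

variable {α : Type*} [Preorder α] {p q r : α} {k l : ℕ}

/-- There is a strictly increasing chain of length `k` from `p` to `q`. -/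
def HasChain (p q : α) (k : ℕ) : Prop :=
  ∃ s : LTSeries α, s.head = p ∧ s.last = q ∧ s.length = k

theorem HasChain.refl (p : α) : HasChain p p 0 := ⟨RelSeries.singleton _ p, rfl, rfl, rfl⟩

theorem HasChain.snoc (h : HasChain p q k) (hqr : q < r) : HasChain p r (k + 1) := by
  obtain ⟨s, rfl, rfl, rfl⟩ := h
  exact ⟨RelSeries.snoc s r hqr, RelSeries.head_snoc .., RelSeries.last_snoc .., rfl⟩

theorem HasChain.trans (h : HasChain p q k) (h' : HasChain q r l) : HasChain p r (k + l) := by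
  obtain ⟨s, rfl, hs, rfl⟩ := h
  obtain ⟨t, ht, rfl, rfl⟩ := h'
  exact ⟨RelSeries.smash s t (hs.trans ht.symm), RelSeries.head_smash .., RelSeries.last_smash ..,
    rfl⟩

theorem HasChain.height_eq_and_coheight_eq (h : HasChain p q k) (h' : HasChain q r l)
    (hdim : Order.krullDim α = (k + l : ℕ)) :
    Order.height q = k ∧ Order.coheight q = l := by
  have : Nonempty α := ⟨q⟩
  have hk : (k : ℕ∞) ≤ Order.height q := by
    obtain ⟨s, -, hs, rfl⟩ := h
    exact Order.length_le_height hs.le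
  have hl : (l : ℕ∞) ≤ Order.coheight q := by
    obtain ⟨s, hs, -, rfl⟩ := h'
    exact Order.length_le_coheight hs.ge
  have hsum : Order.height q + Order.coheight q ≤ (k + l : ℕ) := by
    rw [Order.krullDim_eq_iSup_height_add_coheight_of_nonempty] at hdim
    have hsup : ⨆ a : α, Order.height a + Order.coheight a = ((k + l : ℕ) : ℕ∞) := by
      exact_mod_cast hdim
    exact hsup ▸ le_iSup (fun a : α => Order.height a + Order.coheight a) q
  push_cast at hsum
  constructor
  · refine le_antisymm ((ENat.add_le_add_iff_right (ENat.natCast_ne_top l)).1 ?_) hk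
    exact (add_le_add_right hl _).trans hsum
  · refine le_antisymm ((ENat.add_le_add_iff_left (ENat.natCast_ne_top k)).1 ?_) hl
    exact (add_le_add_left hk _).trans hsum

theorem hasChain_of_lt_insert {ι : Type*} {f : Set ι → α} {N : Set ι} (hN : N.Finite)
    (hf : ∀ s ⊆ N, ∀ i ∈ N, i ∉ s → f s < f (insert i s)) : HasChain (f ∅) (f N) N.ncard := by
  refine Set.Finite.induction_on_subset (motive := fun s _ => HasChain (f ∅) (f s) s.ncard) N hN
    (by simpa using HasChain.refl (f ∅)) fun {i s} hi hs his ih => ?_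
  rw [Set.ncard_insert_of_notMem his (hN.subset hs)]
  exact ih.snoc (hf s hs i hi his)

end Chains

section RingTheory

variable {R : Type*} [CommRing R] {I : Ideal R}

theorem height_eq_of_radical_eq {q : PrimeSpectrum R} (h : I.radical = q.asIdeal) :
    I.height = Order.height q := by
  rw [← PrimeSpectrum.height_eq_orderHeight, ← h, Ideal.height_eq_inf_minimalPrimes,
    Ideal.height_eq_inf_minimalPrimes, Ideal.radical_minimalPrimes]

theorem ringKrullDim_quotient_eq_of_radical_eq {q : PrimeSpectrum R} (h : I.radical = q.asIdeal) :
    ringKrullDim (R ⧸ I) = Order.coheight q := by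
  have hIci : PrimeSpectrum.zeroLocus (I : Set R) = Set.Ici q := by
    rw [← PrimeSpectrum.zeroLocus_radical, h]
    rfl
  rw [ringKrullDim_quotient, hIci, Order.coheight_eq_krullDim_Ici]

theorem ringKrullDim_quotient_le_of_forall_isPrime {d : WithBot ℕ∞}
    (h : ∀ p : Ideal R, p.IsPrime → I ≤ p → ∃ J ≤ p, ringKrullDim (R ⧸ J) ≤ d) :
    ringKrullDim (R ⧸ I) ≤ d := by
  rw [ringKrullDim_quotient]
  refine iSup_le fun s => ?_
  obtain ⟨J, hJ, hd⟩ := h s.head.1.asIdeal s.head.1.2 s.head.2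
  let t : LTSeries (PrimeSpectrum.zeroLocus (J : Set R)) :=
    { length := s.length
      toFun := fun k => ⟨(s k).1, hJ.trans (s.head_le k)⟩
      step := s.step }
  rw [ringKrullDim_quotient] at hd
  exact (Order.LTSeries.length_le_krullDim t).trans hd

theorem minor_mem_trans {Q : Ideal R} [hQ : Q.IsPrime] {a b c d e f : R}
    (h : a * d - c * b ∈ Q) (h' : c * f - e * d ∈ Q) (hcd : ¬(c ∈ Q ∧ d ∈ Q)) :
    a * f - e * b ∈ Q := by
  have hc : c * (a * f - e * b) ∈ Q := by
    convert! Q.add_mem (Q.mul_mem_left e h) (Q.mul_mem_left a h') using 1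
    ring
  have hd : d * (a * f - e * b) ∈ Q := by
    convert! Q.add_mem (Q.mul_mem_left f h) (Q.mul_mem_left b h') using 1
    ring
  exact (not_and_or.1 hcd).elim (hQ.mem_or_mem hc).resolve_left (hQ.mem_or_mem hd).resolve_left

end RingTheory

section CommonLines

variable {F ι : Type*} [Field F]

theorem exists_common_line {u v : ι → F} {S : Set ι}
    (h : ∀ i ∈ S, ∀ j ∈ S, u i * v j - u j * v i = 0) :
    ∃ a b : F, ∀ i ∈ S, ∃ t : F, u i = t * a ∧ v i = t * b := by
  by_cases hS : ∀ i ∈ S, u i = 0 ∧ v i = 0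
  · exact ⟨0, 0, fun i hi => ⟨0, by simp [hS i hi]⟩⟩
  push Not at hS
  obtain ⟨k, hk, huv⟩ := hS
  refine ⟨u k, v k, fun i hi => ?_⟩
  have hik := h i hi k hk
  by_cases hu : u k = 0
  · have hv := huv hu
    exact ⟨v i / v k, by simp_all, by field_simp⟩
  · refine ⟨u i / u k, by field_simp, ?_⟩
    field_simp
    linear_combination -hik

theorem exists_common_lines {L : Type*} {u v : ι → F} (c : ι → L)
    (h : ∀ i j, c i = c j → u i * v j - u j * v i = 0) :
    ∃ (s : ι → F) (a b : L → F), (∀ i, u i = s i * a (c i)) ∧ (∀ i, v i = s i * b (c i)) ∧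
      ∀ i, u i = 0 → v i = 0 → s i = 0 := by
  have hline (l : L) := exists_common_line (u := u) (v := v) (S := c ⁻¹' {l})
    fun i hi j hj => h i j (hi.trans hj.symm)
  choose a b hab using hline
  have hscale (i : ι) : ∃ t, u i = t * a (c i) ∧ v i = t * b (c i) ∧
      (u i = 0 → v i = 0 → t = 0) := by
    by_cases hi : u i = 0 ∧ v i = 0
    · exact ⟨0, by simp [hi]⟩
    · obtain ⟨t, hu, hv⟩ := hab (c i) i rfl
      exact ⟨t, hu, hv, fun hu hv => absurd ⟨hu, hv⟩ hi⟩
  choose s hu hv hs using hscale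
  exact ⟨s, a, b, hu, hv, hs⟩

end CommonLines

open MvPolynomial

section GenericPrimes

variable {K : Type*} [Field K] {V L D : Type*} [CommRing D] [Algebra K D]

theorem polyRing_algHom_ext {φ ψ : PolyRing K V →ₐ[K] D} (hx : ∀ i, φ (x K i) = ψ (x K i))
    (hy : ∀ i, φ (y K i) = ψ (y K i)) : φ = ψ := by
  refine MvPolynomial.algHom_ext fun ⟨k, i⟩ => ?_
  fin_cases k
  exacts [hx i, hy i]

variable (K) in
/-- The configuration with vector `s_i (a_l, b_l)`, `l = c i`, at the vertex `i`, as the evaluation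
`x_i ↦ s_i a_l`, `y_i ↦ s_i b_l`. The vectors of all vertices with a common label are
proportional. -/
noncomputable def lineEval (c : V → L) (s : V → D) (a b : L → D) : PolyRing K V →ₐ[K] D :=
  aeval fun p => s p.2 * if p.1 = 0 then a (c p.2) else b (c p.2)

@[simp]
theorem lineEval_x (c : V → L) (s : V → D) (a b : L → D) (i : V) :
    lineEval K c s a b (x K i) = s i * a (c i) := by simp [lineEval, x]

@[simp]
theorem lineEval_y (c : V → L) (s : V → D) (a b : L → D) (i : V) :
    lineEval K c s a b (y K i) = s i * b (c i) := by simp [lineEval, y]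

theorem lineEval_comp {L' : Type*} (σ : L → L') (c : V → L) (s : V → D) (a b : L' → D) :
    lineEval K (σ ∘ c) s a b = lineEval K c s (a ∘ σ) (b ∘ σ) := rfl

variable (K) in
/-- The generic configuration with line labels `c` in which the vectors of the vertices in `A`
vanish and the lines with labels in `B` are horizontal: the coordinates `s_i` for `i ∉ A`, `a_l`,
and `b_l` for `l ∉ B` are independent variables. -/
noncomputable def genericEval (c : V → L) (A : Set V) (B : Set L) :
    PolyRing K V →ₐ[K] MvPolynomial (V ⊕ L ⊕ L) K :=
  lineEval K c (Aᶜ.indicator fun i => X (.inl i)) (fun l => X (.inr (.inl l)))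
    (Bᶜ.indicator fun l => X (.inr (.inr l)))

theorem ker_genericEval_le {c : V → L} {A : Set V} {B : Set L} {s : V → D} {a b : L → D}
    (hA : ∀ i ∈ A, s i = 0) (hB : ∀ i, c i ∈ B → s i * b (c i) = 0) :
    RingHom.ker (genericEval K c A B) ≤ RingHom.ker (lineEval K c s a b) := by
  let ψ : MvPolynomial (V ⊕ L ⊕ L) K →ₐ[K] D := aeval (Sum.elim s (Sum.elim a b))
  have hψ : lineEval K c s a b = ψ.comp (genericEval K c A B) := by
    refine polyRing_algHom_ext (fun i => ?_) fun i => ?_ <;> by_cases hi : i ∈ A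
    · simp [genericEval, hi, hA]
    · simp [genericEval, hi, ψ]
    · simp [genericEval, hi, hA]
    · by_cases hci : c i ∈ B
      · simp [genericEval, hci, hB]
      · simp [genericEval, hi, hci, ψ]
  intro f hf
  rw [RingHom.mem_ker] at hf ⊢
  rw [hψ, AlgHom.comp_apply, hf, map_zero]

variable (K) in
/-- The vanishing ideal of the family of vector configurations parametrized by `genericEval`. -/
noncomputable def genericPrime (c : V → L) (A : Set V) (B : Set L) :
    PrimeSpectrum (PolyRing K V) :=
  ⟨RingHom.ker (genericEval K c A B), RingHom.ker_isPrime _⟩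

variable {c : V → L} {A : Set V} {B : Set L}

theorem genericPrime_mono {A' : Set V} {B' : Set L} (hA : A ⊆ A') (hB : B ⊆ B') :
    genericPrime K c A B ≤ genericPrime K c A' B' :=
  ker_genericEval_le (fun i hi => by simp [hA hi]) fun i hi => by simp [hB hi]

theorem genericPrime_le_comp {L' : Type*} {B' : Set L'} {σ : L → L'} (hσ : Set.MapsTo σ B B') :
    genericPrime K c A B ≤ genericPrime K (σ ∘ c) A B' := by
  change _ ≤ RingHom.ker (lineEval K (σ ∘ c) _ _ _)
  rw [lineEval_comp]
  exact ker_genericEval_le (fun i hi => by simp [hi]) fun i hi => by simp [hσ hi]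

theorem genericPrime_lt {L' : Type*} {c' : V → L'} {A' : Set V} {B' : Set L'} (f : PolyRing K V)
    (hle : genericPrime K c A B ≤ genericPrime K c' A' B') (hf : genericEval K c A B f ≠ 0)
    (hf' : genericEval K c' A' B' f = 0) : genericPrime K c A B < genericPrime K c' A' B' :=
  lt_of_le_not_ge hle fun hge => hf (hge hf')

theorem genericPrime_lt_insert_vertex {i : V} (hi : i ∉ A) :
    genericPrime K c A B < genericPrime K c (insert i A) B :=
  genericPrime_lt (x K i) (genericPrime_mono (Set.subset_insert i A) subset_rfl)
    (by simp [genericEval, hi]) (by simp [genericEval])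

theorem genericPrime_lt_insert_label {i : V} (hi : i ∉ A) (hci : c i ∉ B) :
    genericPrime K c A B < genericPrime K c A (insert (c i) B) :=
  genericPrime_lt (y K i) (genericPrime_mono subset_rfl (Set.subset_insert _ B))
    (by simp [genericEval, hi, hci]) (by simp [genericEval])

theorem genericPrime_lt_merge {c' : V → L} {i j : V} (hi : i ∉ A) (hj : j ∉ A) (hci : c i ∉ B)
    (hcj : c j ∉ B) (hij : c i ≠ c j) (hmerge : ∀ k, c k = c i → c' k = c j)
    (hc' : ∀ k, c k ≠ c i → c' k = c k) : genericPrime K c A B < genericPrime K c' A B := by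
  classical
  obtain rfl : c' = Function.update id (c i) (c j) ∘ c := by
    funext k
    by_cases hk : c k = c i
    · simp [hk, hmerge k hk]
    · simp [hk, hc' k hk]
  have hσ : Set.MapsTo (Function.update id (c i) (c j)) B B := fun l hl => by
    have hne : l ≠ c i := by rintro rfl; exact hci hl
    simpa only [Function.update_of_ne hne, id_eq] using hl
  refine genericPrime_lt (x K i * y K j - x K j * y K i) (genericPrime_le_comp hσ) (fun h => ?_) ?_
  · have := congrArg (MvPolynomial.eval
      (Function.update (fun _ => (1 : K)) (.inr (.inr (c i))) 0)) h
    simp [genericEval, hi, hj, hci, hcj, hij.symm] at this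
  · simp only [genericEval, map_sub, map_mul, lineEval_x, lineEval_y, Function.comp_apply,
      Function.update_self, Function.update_of_ne hij.symm, id_eq]
    ring

end GenericPrimes

section Heights

variable {K : Type*} [Field K] {V : Type*}

theorem hasChain_union_vertices [Finite V] {c : V → V} {A B C : Set V} (hAC : Disjoint A C) :
    HasChain (genericPrime K c A B) (genericPrime K c (A ∪ C) B) C.ncard := by
  suffices h : HasChain (genericPrime K c (A ∪ ∅) B) (genericPrime K c (A ∪ C) B) C.ncard by
    rwa [Set.union_empty] at h
  refine hasChain_of_lt_insert (f := fun s => genericPrime K c (A ∪ s) B) C.toFinite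
    fun s _ i hi his => ?_
  rw [Set.union_insert]
  exact genericPrime_lt_insert_vertex (not_or.2 ⟨hAC.notMem_of_mem_right hi, his⟩)

theorem hasChain_union_labels [Finite V] {c : V → V} {A B C : Set V} (hAC : Disjoint A C)
    (hBC : Disjoint B C) (hc : ∀ i ∈ C, c i = i) :
    HasChain (genericPrime K c A B) (genericPrime K c A (B ∪ C)) C.ncard := by
  suffices h : HasChain (genericPrime K c A (B ∪ ∅)) (genericPrime K c A (B ∪ C)) C.ncard by
    rwa [Set.union_empty] at h
  refine hasChain_of_lt_insert (f := fun s => genericPrime K c A (B ∪ s)) C.toFinite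
    fun s _ i hi his => ?_
  have hlt := genericPrime_lt_insert_label (K := K) (c := c) (B := B ∪ s)
    (hAC.notMem_of_mem_right hi)
  rw [hc i hi] at hlt
  rw [Set.union_insert]
  exact hlt (not_or.2 ⟨hBC.notMem_of_mem_right hi, his⟩)

variable {r : V → V} {T : Set V}

theorem hasChain_merge [Finite V] (hr : ∀ i, r (r i) = r i)
    (hrT : ∀ i, r i ≠ i → i ∉ T ∧ r i ∉ T) :
    HasChain (genericPrime K id T T) (genericPrime K r T T) {i | r i ≠ i}.ncard := by
  classical
  let c (s : Set V) (j : V) : V := if j ∈ s then r j else j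
  have hmem {s : Set V} {j : V} (hj : j ∈ s) : c s j = r j := if_pos hj
  have hnot {s : Set V} {j : V} (hj : j ∉ s) : c s j = j := if_neg hj
  have hnone : c ∅ = id := funext fun j => hnot (Set.notMem_empty j)
  have hall : c {i | r i ≠ i} = r := funext fun j => by
    by_cases hj : r j = j
    · rw [hnot (not_not.2 hj), hj]
    · exact hmem hj
  suffices h : HasChain (genericPrime K (c ∅) T T) (genericPrime K (c {i | r i ≠ i}) T T)
      {i | r i ≠ i}.ncard by
    rwa [hnone, hall] at h
  refine hasChain_of_lt_insert (f := fun s => genericPrime K (c s) T T) {i | r i ≠ i}.toFinite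
    fun s hs i hi his => ?_
  obtain ⟨hiT, hriT⟩ := hrT i hi
  have hris : r i ∉ s := fun h => hs h (hr i)
  refine genericPrime_lt_merge hiT hriT ?_ ?_ ?_ (fun j hj => ?_) fun j hj => ?_
  · rwa [hnot his]
  · rwa [hnot hris]
  · rw [hnot his, hnot hris]
    exact Ne.symm hi
  · have hjs : j ∉ s := fun hjs => hi <| by
      rw [hmem hjs, hnot his] at hj
      rw [← hj, hr]
    obtain rfl : j = i := by rwa [hnot hjs, hnot his] at hj
    rw [hnot hris, hmem (Set.mem_insert j s)]
  · have hji : j ≠ i := by rintro rfl; exact hj rfl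
    simp only [c, Set.mem_insert_iff, hji, false_or]

theorem height_and_coheight_genericPrime [Finite V] (hr : ∀ i, r (r i) = r i)
    (hrT : ∀ i, r i ≠ i → i ∉ T ∧ r i ∉ T) :
    Order.height (genericPrime K r T T) = (2 * T.ncard + {i | r i ≠ i}.ncard : ℕ) ∧
      Order.coheight (genericPrime K r T T) =
        ({i | i ∉ T ∧ r i = i}.ncard + Tᶜ.ncard : ℕ) := by
  have hflat : HasChain (genericPrime K id ∅ ∅) (genericPrime K id ∅ T) T.ncard := by
    simpa only [Set.empty_union] using hasChain_union_labels (K := K) (c := id)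
      (Set.empty_disjoint T) (Set.empty_disjoint T) fun _ _ => rfl
  have hkill : HasChain (genericPrime K id ∅ T) (genericPrime K id T T) T.ncard := by
    simpa only [Set.empty_union] using hasChain_union_vertices (K := K) (c := id) (B := T)
      (Set.empty_disjoint T)
  have hflat' := hasChain_union_labels (K := K) (c := r) (A := T) (B := T)
    (C := {i | i ∉ T ∧ r i = i}) (Set.disjoint_right.2 fun _ h => h.1)
    (Set.disjoint_right.2 fun _ h => h.1) fun _ h => h.2
  have hkill' := hasChain_union_vertices (K := K) (c := r) (B := T ∪ {i | i ∉ T ∧ r i = i})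
    (disjoint_compl_right (a := T))
  -- Flattening the lines of `T` before killing its vertices gives two steps per vertex of `T`.
  rw [two_mul]
  refine ((hflat.trans hkill).trans (hasChain_merge hr hrT)).height_eq_and_coheight_eq
    (hflat'.trans hkill') ?_
  have hC : {i | i ∉ T ∧ r i = i} = Tᶜ \ {i | r i ≠ i} := by
    ext i
    simp
  have hcard := Set.ncard_sdiff_add_ncard_of_subset (s := {i | r i ≠ i}) (t := Tᶜ)
    fun i hi => (hrT i hi).1
  have hT := T.ncard_add_ncard_compl
  change ringKrullDim (PolyRing K V) = _
  rw [MvPolynomial.ringKrullDim_of_isNoetherianRing, ringKrullDim_eq_zero_of_field, zero_add,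
    Nat.card_prod, Nat.card_fin]
  have h : 2 * Nat.card V = T.ncard + T.ncard + {i | r i ≠ i}.ncard +
      ({i | i ∉ T ∧ r i = i}.ncard + Tᶜ.ncard) := by
    rw [hC]
    omega
  exact_mod_cast congrArg (Nat.cast : ℕ → WithBot ℕ∞) h

end Heights

section Components

variable {V : Type*} {G : SimpleGraph V} {T : Set V}

/-- The number `c(T)` of connected components of the graph after deleting the vertices in `T`. -/
noncomputable def numComponents (G : SimpleGraph V) (T : Set V) : ℕ :=
  Nat.card (G.induce Tᶜ).ConnectedComponent

theorem out_injective : Function.Injective (Quot.out : G.ConnectedComponent → V) :=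
  Function.LeftInverse.injective Quot.out_eq

open Classical in
/-- A chosen vertex in the connected component of `i` after deleting `T`. The vertices of `T`
represent themselves. -/
noncomputable def componentRep (G : SimpleGraph V) (T : Set V) (i : V) : V :=
  if h : i ∈ Tᶜ then ((G.induce Tᶜ).connectedComponentMk ⟨i, h⟩).out else i

theorem componentRep_coe (i : (Tᶜ : Set V)) :
    componentRep G T i = ((G.induce Tᶜ).connectedComponentMk i).out :=
  dif_pos i.2

theorem componentRep_of_mem {i : V} (hi : i ∈ T) : componentRep G T i = i :=
  dif_neg (not_not.2 hi)

theorem componentRep_mem_iff {i : V} : componentRep G T i ∈ T ↔ i ∈ T := by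
  refine ⟨fun h => by_contra fun hi => ?_, fun hi => by rwa [componentRep_of_mem hi]⟩
  rw [componentRep_coe ⟨i, hi⟩] at h
  exact (Quot.out _ : (Tᶜ : Set V)).2 h

theorem componentRep_eq_iff {i j : (Tᶜ : Set V)} :
    componentRep G T i = componentRep G T j ↔ (G.induce Tᶜ).Reachable i j := by
  rw [componentRep_coe, componentRep_coe, Subtype.coe_inj]
  exact out_injective.eq_iff.trans SimpleGraph.ConnectedComponent.eq

theorem componentRep_out (c : (G.induce Tᶜ).ConnectedComponent) :
    componentRep G T c.out = c.out := by
  rw [componentRep_coe]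
  exact congrArg (fun d : (G.induce Tᶜ).ConnectedComponent => (d.out : V)) (Quot.out_eq c)

theorem componentRep_componentRep (i : V) :
    componentRep G T (componentRep G T i) = componentRep G T i := by
  by_cases hi : i ∈ T
  · rw [componentRep_of_mem hi, componentRep_of_mem hi]
  · rw [componentRep_coe ⟨i, hi⟩, componentRep_out]

theorem ncard_fixed_componentRep :
    {i | i ∉ T ∧ componentRep G T i = i}.ncard = numComponents G T := by
  have hrange : {i | i ∉ T ∧ componentRep G T i = i} =
      Set.range fun c : (G.induce Tᶜ).ConnectedComponent => (c.out : V) := by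
    ext i
    constructor
    · rintro ⟨hi, hri⟩
      exact ⟨_, (componentRep_coe ⟨i, hi⟩).symm.trans hri⟩
    · rintro ⟨c, rfl⟩
      exact ⟨c.out.2, componentRep_out c⟩
  rw [hrange, ← Nat.card_coe_set_eq]
  exact Nat.card_range_of_injective (Subtype.val_injective.comp out_injective)

theorem numComponents_le_ncard_compl [Finite V] (G : SimpleGraph V) (T : Set V) :
    numComponents G T ≤ Tᶜ.ncard := by
  rw [← ncard_fixed_componentRep]
  exact Set.ncard_le_ncard fun i hi => hi.1

end Components

section Ideals

variable {K : Type*} [Field K] {V : Type*} {G : SimpleGraph V} {T : Set V}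

theorem edgeIdeal_le_iff {I : Ideal (PolyRing K V)} :
    edgeIdeal K G ≤ I ↔ ∀ i j, G.Adj i j → x K i * y K j - x K j * y K i ∈ I := by
  rw [edgeIdeal, Ideal.span_le]
  constructor
  · exact fun h i j hij => h ⟨i, j, hij, rfl⟩
  · rintro h _ ⟨i, j, hij, rfl⟩
    exact h i j hij

theorem span_variables_le_iff {I : Ideal (PolyRing K V)} :
    Ideal.span (⋃ i ∈ T, {x K i, y K i}) ≤ I ↔ ∀ i ∈ T, x K i ∈ I ∧ y K i ∈ I := by
  simp only [Ideal.span_le, Set.iUnion_subset_iff, Set.insert_subset_iff, Set.singleton_subset_iff,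
    SetLike.mem_coe]

theorem primeIdeal_le_iff {I : Ideal (PolyRing K V)} :
    primeIdeal K G T ≤ I ↔ (∀ i ∈ T, x K i ∈ I ∧ y K i ∈ I) ∧
      ∀ i j : (Tᶜ : Set V), (G.induce Tᶜ).Reachable i j →
        x K i.1 * y K j.1 - x K j.1 * y K i.1 ∈ I := by
  rw [primeIdeal, sup_le_iff, iSup_le_iff, span_variables_le_iff]
  refine and_congr_right fun _ => ?_
  simp only [edgeIdeal_le_iff, SimpleGraph.map_adj, SimpleGraph.top_adj]
  constructor
  · intro h i j hij
    by_cases hne : i = j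
    · rw [hne, sub_self]
      exact I.zero_mem
    · refine h ((G.induce Tᶜ).connectedComponentMk i) i j ⟨⟨i, i, rfl, rfl⟩, ⟨j, j, ?_, rfl⟩, ?_⟩
      · exact SimpleGraph.ConnectedComponent.sound hij.symm
      · exact ⟨fun h => hne (Subtype.ext (Subtype.mk.inj h)), rfl, rfl⟩
  · rintro h c _ _ ⟨⟨_, i, hi, rfl⟩, ⟨_, j, hj, rfl⟩, -, rfl, rfl⟩
    exact h i j (SimpleGraph.ConnectedComponent.exact (Eq.trans hi (Eq.symm hj)))

theorem edgeIdeal_le_primeIdeal (T : Set V) : edgeIdeal K G ≤ primeIdeal K G T := by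
  obtain ⟨hvar, hminor⟩ := primeIdeal_le_iff.1 (le_refl (primeIdeal K G T))
  refine edgeIdeal_le_iff.2 fun i j hij => ?_
  by_cases hi : i ∈ T
  · exact sub_mem (Ideal.mul_mem_right _ _ (hvar i hi).1) (Ideal.mul_mem_left _ _ (hvar i hi).2)
  by_cases hj : j ∈ T
  · exact sub_mem (Ideal.mul_mem_left _ _ (hvar j hj).2) (Ideal.mul_mem_right _ _ (hvar j hj).1)
  exact hminor ⟨i, hi⟩ ⟨j, hj⟩ (SimpleGraph.Adj.reachable hij)

theorem exists_primeIdeal_le_of_edgeIdeal_le {Q : Ideal (PolyRing K V)} [Q.IsPrime]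
    (hQ : edgeIdeal K G ≤ Q) : ∃ T, primeIdeal K G T ≤ Q := by
  refine ⟨{i | x K i ∈ Q ∧ y K i ∈ Q}, primeIdeal_le_iff.2 ⟨fun _ hi => hi, fun i j hij => ?_⟩⟩
  rw [SimpleGraph.reachable_iff_reflTransGen] at hij
  induction hij with
  | refl => simp only [sub_self, Q.zero_mem]
  | @tail k l _ hkl ih => exact minor_mem_trans ih (edgeIdeal_le_iff.1 hQ k l hkl) k.2

theorem primeIdeal_le_genericPrime :
    primeIdeal K G T ≤ (genericPrime K (componentRep G T) T T).asIdeal := by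
  change _ ≤ RingHom.ker (genericEval K (componentRep G T) T T)
  refine primeIdeal_le_iff.2 ⟨fun i hi => ?_, fun i j hij => ?_⟩
  · simp [RingHom.mem_ker, genericEval, hi]
  · simp only [RingHom.mem_ker, genericEval, map_sub, map_mul, lineEval_x, lineEval_y,
      componentRep_eq_iff.2 hij]
    ring

theorem exists_algHom_ker_eq (Q : Ideal (PolyRing K V)) [Q.IsPrime] :
    ∃ φ : PolyRing K V →ₐ[K] FractionRing (PolyRing K V ⧸ Q), RingHom.ker φ = Q := by
  refine ⟨(IsScalarTower.toAlgHom K (PolyRing K V ⧸ Q) _).comp (Ideal.Quotient.mkₐ K Q), ?_⟩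
  ext f
  rw [RingHom.mem_ker, ← Ideal.Quotient.eq_zero_iff_mem]
  exact (IsFractionRing.injective (PolyRing K V ⧸ Q) _).eq_iff' (map_zero _)

theorem genericPrime_le_of_primeIdeal_le {Q : Ideal (PolyRing K V)} [Q.IsPrime]
    (hQ : primeIdeal K G T ≤ Q) : (genericPrime K (componentRep G T) T T).asIdeal ≤ Q := by
  obtain ⟨φ, hφ⟩ := exists_algHom_ker_eq Q
  obtain ⟨hvar, hminor⟩ := primeIdeal_le_iff.1 (hQ.trans_eq hφ.symm)
  simp only [RingHom.mem_ker, map_sub, map_mul] at hvar hminor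
  have hparallel (i j : V) (hij : componentRep G T i = componentRep G T j) :
      φ (x K i) * φ (y K j) - φ (x K j) * φ (y K i) = 0 := by
    by_cases hi : i ∈ T
    · simp [hvar i hi]
    by_cases hj : j ∈ T
    · simp [hvar j hj]
    exact hminor ⟨i, hi⟩ ⟨j, hj⟩ (componentRep_eq_iff.1 hij)
  obtain ⟨s, a, b, hx, hy, hs⟩ := exists_common_lines (componentRep G T) hparallel
  have hsT (i : V) (hi : i ∈ T) : s i = 0 := hs i (hvar i hi).1 (hvar i hi).2
  have hline : φ = lineEval K (componentRep G T) s a b :=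
    polyRing_algHom_ext (fun i => by rw [hx, lineEval_x]) fun i => by rw [hy, lineEval_y]
  rw [← hφ, hline]
  exact ker_genericEval_le hsT fun i hi => by rw [hsT i (componentRep_mem_iff.1 hi), zero_mul]

theorem radical_primeIdeal :
    (primeIdeal K G T).radical = (genericPrime K (componentRep G T) T T).asIdeal := by
  refine le_antisymm ?_ ?_
  · exact (genericPrime K _ T T).2.radical_le_iff.2 primeIdeal_le_genericPrime
  · rw [Ideal.radical_eq_sInf]
    exact le_sInf fun Q ⟨hQ, _⟩ => genericPrime_le_of_primeIdeal_le hQ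

theorem height_and_coheight_genericPrime_componentRep [Finite V] :
    Order.height (genericPrime K (componentRep G T) T T) =
        (T.ncard + Nat.card V - numComponents G T : ℕ) ∧
      Order.coheight (genericPrime K (componentRep G T) T T) =
        (Tᶜ.ncard + numComponents G T : ℕ) := by
  have hmoved (i : V) (hi : componentRep G T i ≠ i) : i ∉ T := fun h => hi (componentRep_of_mem h)
  obtain ⟨hheight, hcoheight⟩ := height_and_coheight_genericPrime (K := K) (T := T)
    (componentRep_componentRep (G := G)) fun i hi =>
      ⟨hmoved i hi, fun h => hmoved i hi (componentRep_mem_iff.1 h)⟩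
  have hcompl : Tᶜ \ {i | i ∉ T ∧ componentRep G T i = i} = {i | componentRep G T i ≠ i} := by
    ext i
    simp only [Set.mem_sdiff, Set.mem_compl_iff, Set.mem_ofPred_eq, not_and]
    exact ⟨fun h => h.2 h.1, fun h => ⟨hmoved i h, fun _ => h⟩⟩
  have hfixed := Set.ncard_sdiff_add_ncard_of_subset
    (s := {i | i ∉ T ∧ componentRep G T i = i}) (t := Tᶜ) fun i hi => hi.1
  have hT := T.ncard_add_ncard_compl
  rw [hcompl, ncard_fixed_componentRep] at hfixed
  rw [hheight, hcoheight, ncard_fixed_componentRep]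
  constructor <;> congr 1 <;> omega

-- The subtraction does not truncate, by `numComponents_le_ncard_compl`.
theorem height_primeIdeal [Finite V] :
    (primeIdeal K G T).height = (T.ncard + Nat.card V - numComponents G T : ℕ) := by
  rw [height_eq_of_radical_eq radical_primeIdeal, height_and_coheight_genericPrime_componentRep.1]

theorem ringKrullDim_quotient_primeIdeal [Finite V] :
    ringKrullDim (PolyRing K V ⧸ primeIdeal K G T) = (Tᶜ.ncard + numComponents G T : ℕ) := by
  rw [ringKrullDim_quotient_eq_of_radical_eq radical_primeIdeal,
    height_and_coheight_genericPrime_componentRep.2]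
  rfl

end Ideals

section CutSets

variable {V : Type*} {G : SimpleGraph V} {T : Set V}

theorem numComponents_univ : numComponents G Set.univ = 0 := by
  have : IsEmpty (G.induce (Set.univᶜ : Set V)).ConnectedComponent := ⟨fun c => c.out.2 trivial⟩
  exact Nat.card_of_isEmpty

theorem numComponents_pos [Finite V] {i : V} (hi : i ∉ T) : 0 < numComponents G T := by
  have : Nonempty (G.induce Tᶜ).ConnectedComponent :=
    ⟨(G.induce Tᶜ).connectedComponentMk ⟨i, hi⟩⟩
  exact Nat.card_pos

theorem numComponents_eq_one (h : (G.induce Tᶜ).Connected) : numComponents G T = 1 := by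
  have := h.preconnected.subsingleton_connectedComponent
  have := h.nonempty
  exact Nat.card_eq_one_iff_unique.2 ⟨inferInstance, inferInstance⟩

theorem numComponents_empty (h : G.Connected) : numComponents G ∅ = 1 := by
  refine numComponents_eq_one ?_
  rw [Set.compl_empty]
  exact (SimpleGraph.induceUnivIso G).connected_iff.2 h

theorem hasCutPointProperty_iff :
    HasCutPointProperty G T ↔ ∀ i ∈ T, numComponents G (T \ {i}) < numComponents G T := by
  refine forall₂_congr fun i hi => ?_
  have hcard : Nat.card (G.induce (Tᶜ ∪ {i})).ConnectedComponent = numComponents G (T \ {i}) := by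
    rw [numComponents, Set.sdiff_eq, Set.compl_inter, compl_compl]
  let e : (G.induce (Tᶜ ∪ {i})).induce ({⟨i, Or.inr rfl⟩}ᶜ : Set (Tᶜ ∪ {i} : Set V)) ≃g
      G.induce Tᶜ :=
    { toFun := fun v => ⟨v.1.1, v.1.2.resolve_right fun h => v.2 (Subtype.ext h)⟩
      invFun := fun v => ⟨⟨v.1, Or.inl v.2⟩, fun h => v.2 ((Subtype.mk.inj h).symm ▸ hi)⟩
      left_inv := fun _ => rfl
      right_inv := fun _ => rfl
      map_rel_iff' := Iff.rfl }
  rw [IsCutPoint, hcard, Nat.card_congr e.connectedComponentEquiv]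
  rfl

theorem mem_cutSetsBar_iff : T ∈ cutSetsBar G ↔
    T.Nonempty ∧ ∀ i ∈ T, numComponents G (T \ {i}) < numComponents G T := by
  rw [cutSetsBar, cutSets, ← hasCutPointProperty_iff, Set.nonempty_iff_ne_empty]
  simp only [Set.mem_sdiff, Set.mem_union, Set.mem_singleton_iff, Set.mem_ofPred_eq]
  tauto

theorem empty_mem_cutSets : ∅ ∈ cutSets G := Or.inl rfl

theorem cutSets_eq : cutSets G = {∅} ∪ cutSetsBar G := by
  rw [cutSetsBar, Set.union_sdiff_self, Set.union_eq_right.2]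
  exact Set.singleton_subset_iff.2 empty_mem_cutSets

theorem one_lt_numComponents_of_mem_cutSetsBar [Finite V] (hT : T ∈ cutSetsBar G) :
    1 < numComponents G T := by
  obtain ⟨⟨i, hi⟩, hcut⟩ := mem_cutSetsBar_iff.1 hT
  have hpos := numComponents_pos (G := G) (T := T \ {i}) (i := i) fun h => h.2 rfl
  have hlt := hcut i hi
  omega

theorem exists_notMem_of_mem_cutSetsBar [Finite V] (hT : T ∈ cutSetsBar G) : ∃ i, i ∉ T := by
  by_contra! hall
  have hlt := one_lt_numComponents_of_mem_cutSetsBar hT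
  rw [Set.eq_univ_of_forall hall, numComponents_univ] at hlt
  omega

theorem exists_mem_cutSets_subset [Finite V] (G : SimpleGraph V) (T : Set V) :
    ∃ T' ∈ cutSets G, T' ⊆ T ∧ numComponents G T ≤ numComponents G T' := by
  obtain ⟨T', ⟨hsub, hle⟩, hmin⟩ := Set.exists_min_image
    {S | S ⊆ T ∧ numComponents G T ≤ numComponents G S} Set.ncard (Set.toFinite _)
    ⟨T, subset_rfl, le_rfl⟩
  refine ⟨T', Or.inr (hasCutPointProperty_iff.2 fun i hi => ?_), hsub, hle⟩
  by_contra! hnot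
  have hsmaller := hmin (T' \ {i}) ⟨Set.sdiff_subset.trans hsub, hle.trans hnot⟩
  have hcard := Set.ncard_sdiff_singleton_lt_of_mem hi
  omega

end CutSets

section EdgeIdeal

variable (K : Type*) [Field K] {V : Type*} [Finite V] (G : SimpleGraph V)

theorem exists_mem_cutSets_height_le_and_ringKrullDim_le (T : Set V) :
    ∃ T' ∈ cutSets G, (primeIdeal K G T').height ≤ (primeIdeal K G T).height ∧
      ringKrullDim (PolyRing K V ⧸ primeIdeal K G T) ≤
        ringKrullDim (PolyRing K V ⧸ primeIdeal K G T') := by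
  obtain ⟨T', hT', hsub, hle⟩ := exists_mem_cutSets_subset G T
  have hcard := Set.ncard_le_ncard hsub
  have hcompl := Set.ncard_le_ncard (Set.compl_subset_compl.2 hsub)
  refine ⟨T', hT', ?_, ?_⟩
  · rw [height_primeIdeal, height_primeIdeal]
    exact_mod_cast by omega
  · rw [ringKrullDim_quotient_primeIdeal, ringKrullDim_quotient_primeIdeal]
    exact_mod_cast by omega

theorem isLeast_height_edgeIdeal :
    IsLeast ((fun T => (primeIdeal K G T).height) '' cutSets G) (edgeIdeal K G).height := by
  have hle (T : Set V) : (edgeIdeal K G).height ≤ (primeIdeal K G T).height :=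
    Ideal.height_mono (edgeIdeal_le_primeIdeal T)
  have hfin : (edgeIdeal K G).height ≠ ⊤ :=
    ne_top_of_le_ne_top (by rw [height_primeIdeal]; exact ENat.natCast_ne_top _) (hle ∅)
  obtain ⟨n, hn⟩ := ENat.ne_top_iff_exists.1 hfin
  obtain ⟨Q, hQ, hJQ, hQn⟩ := Ideal.exists_isPrime_height_eq hn.symm
  obtain ⟨T₀, hT₀⟩ := exists_primeIdeal_le_of_edgeIdeal_le hJQ
  obtain ⟨T, hT, hheight, -⟩ := exists_mem_cutSets_height_le_and_ringKrullDim_le K G T₀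
  refine ⟨⟨T, hT, le_antisymm ?_ (hle T)⟩, Set.forall_mem_image.2 fun T _ => hle T⟩
  rw [← hn, ← hQn]
  exact hheight.trans (Ideal.height_mono hT₀)

theorem isGreatest_ringKrullDim_quotient_edgeIdeal :
    IsGreatest ((fun T => ringKrullDim (PolyRing K V ⧸ primeIdeal K G T)) '' cutSets G)
      (ringKrullDim (PolyRing K V ⧸ edgeIdeal K G)) := by
  have hle (T : Set V) : ringKrullDim (PolyRing K V ⧸ primeIdeal K G T) ≤
      ringKrullDim (PolyRing K V ⧸ edgeIdeal K G) :=
    ringKrullDim_le_of_surjective (Ideal.Quotient.factor (edgeIdeal_le_primeIdeal T))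
      (Ideal.Quotient.factor_surjective _)
  obtain ⟨T, hT, hmax⟩ := Set.exists_max_image (cutSets G)
    (fun T => ringKrullDim (PolyRing K V ⧸ primeIdeal K G T)) (Set.toFinite _)
    ⟨∅, empty_mem_cutSets⟩
  refine ⟨⟨T, hT, le_antisymm (hle T) ?_⟩, Set.forall_mem_image.2 fun T _ => hle T⟩
  refine ringKrullDim_quotient_le_of_forall_isPrime fun Q hQ hJQ => ?_
  obtain ⟨T₀, hT₀⟩ := exists_primeIdeal_le_of_edgeIdeal_le hJQ
  obtain ⟨T', hT', -, hdim⟩ := exists_mem_cutSets_height_le_and_ringKrullDim_le K G T₀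
  exact ⟨_, hT₀, hdim.trans (hmax T' hT')⟩

end EdgeIdeal

section KernImage

variable {α β : Type*} {f : α → β}

theorem kernImage_eq_image_union (hf : f.Injective) (A : Set α) :
    Set.kernImage f A = f '' A ∪ (Set.range f)ᶜ := by
  rw [← Set.kernImage_empty, ← Set.kernImage_preimage_union, Set.preimage_image_eq A hf,
    Set.union_empty]

theorem kernImage_sdiff_singleton (A : Set α) (a : α) :
    Set.kernImage f (A \ {a}) = Set.kernImage f A \ {f a} := by
  simp only [Set.kernImage_eq_compl, Set.sdiff_eq, Set.compl_inter, compl_compl, Set.image_union,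
    Set.image_singleton, Set.compl_union]

theorem ncard_kernImage [Finite α] [Finite β] (hf : f.Injective) (A : Set α) :
    (Set.kernImage f A).ncard = A.ncard + (Set.range f)ᶜ.ncard := by
  rw [kernImage_eq_image_union hf, Set.ncard_union_eq, Set.ncard_image_of_injective A hf]
  exact Set.disjoint_compl_right_iff_subset.2 (Set.image_subset_range f A)

end KernImage

section Embeddings

variable {V W : Type*} {G : SimpleGraph V} {H : SimpleGraph W} (f : G ↪g H)

theorem numComponents_kernImage (A : Set V) :
    numComponents H (Set.kernImage f A) = numComponents G A := by
  let e : G.induce Aᶜ ≃g H.induce (Set.kernImage f A)ᶜ :=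
    { (Equiv.Set.image f Aᶜ f.injective).trans
        (Equiv.setCongr (by rw [Set.kernImage_eq_compl, compl_compl])) with
      map_rel_iff' := f.map_rel_iff }
  exact (Nat.card_congr e.connectedComponentEquiv).symm

section Ideals

variable (K : Type*) [Field K] [Finite V] [Finite W]

theorem height_primeIdeal_kernImage (A : Set V) :
    (primeIdeal K H (Set.kernImage f A)).height =
      (primeIdeal K G A).height + 2 * ((Set.range f)ᶜ.ncard : ℕ∞) := by
  have hrange : (Set.range f).ncard = Nat.card V := Set.ncard_range_of_injective f.injective
  have hW := (Set.range f).ncard_add_ncard_compl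
  have hle := (numComponents_le_ncard_compl G A).trans (Set.ncard_le_card Aᶜ)
  rw [height_primeIdeal, height_primeIdeal, numComponents_kernImage,
    ncard_kernImage f.injective]
  exact_mod_cast by omega

theorem ringKrullDim_quotient_primeIdeal_kernImage (A : Set V) :
    ringKrullDim (PolyRing K W ⧸ primeIdeal K H (Set.kernImage f A)) =
      ringKrullDim (PolyRing K V ⧸ primeIdeal K G A) := by
  rw [ringKrullDim_quotient_primeIdeal, ringKrullDim_quotient_primeIdeal, numComponents_kernImage,
    Set.kernImage_eq_compl, compl_compl, Set.ncard_image_of_injective _ f.injective]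

end Ideals

variable {f}

theorem numComponents_eq_one_of_adj (hf : ∀ v, ∀ w ∉ Set.range f, H.Adj (f v) w) {T : Set W} {v : V}
    {w : W} (hv : f v ∉ T) (hw : w ∉ Set.range f) (hwT : w ∉ T) : numComponents H T = 1 := by
  have hadj (v' : V) (w' : W) (hv' : f v' ∉ T) (hw' : w' ∉ Set.range f) (hw'T : w' ∉ T) :
      (H.induce Tᶜ).Adj ⟨f v', hv'⟩ ⟨w', hw'T⟩ := hf v' w' hw'
  refine numComponents_eq_one
    ((SimpleGraph.connected_iff_exists_forall_reachable _).2 ⟨⟨w, hwT⟩, ?_⟩)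
  rintro ⟨u, hu⟩
  by_cases hur : u ∈ Set.range f
  · obtain ⟨v', rfl⟩ := hur
    exact (hadj v' w hu hw hwT).symm.reachable
  · exact (hadj v w hv hw hwT).symm.reachable.trans (hadj v u hv hur hu).reachable

theorem kernImage_mem_cutSetsBar [Finite V] (hf : ∀ v, ∀ w ∉ Set.range f, H.Adj (f v) w) {A : Set V}
    (hA : A ∈ cutSetsBar G) : Set.kernImage f A ∈ cutSetsBar H := by
  obtain ⟨v, hv⟩ := exists_notMem_of_mem_cutSetsBar hA
  have hlt := one_lt_numComponents_of_mem_cutSetsBar hA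
  obtain ⟨hne, hcut⟩ := mem_cutSetsBar_iff.1 hA
  rw [mem_cutSetsBar_iff, numComponents_kernImage, kernImage_eq_image_union f.injective]
  refine ⟨(hne.image f).inl, ?_⟩
  rw [← kernImage_eq_image_union f.injective]
  intro w hw
  by_cases hwr : w ∈ Set.range f
  · obtain ⟨i, rfl⟩ := hwr
    rw [← kernImage_sdiff_singleton, numComponents_kernImage]
    exact hcut i (hw rfl)
  · have hv' : f v ∉ Set.kernImage f A \ {w} := fun h => hv (h.1 rfl)
    rwa [numComponents_eq_one_of_adj hf hv' hwr fun h => h.2 rfl]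

theorem mem_cutSetsBar_of_kernImage_mem [Finite W] (hG : G.Connected) {A : Set V}
    (hA : Set.kernImage f A ∈ cutSetsBar H) : A ∈ cutSetsBar G := by
  have hlt := one_lt_numComponents_of_mem_cutSetsBar hA
  obtain ⟨-, hcut⟩ := mem_cutSetsBar_iff.1 hA
  rw [numComponents_kernImage] at hlt hcut
  refine mem_cutSetsBar_iff.2 ⟨Set.nonempty_iff_ne_empty.2 ?_, fun i hi => ?_⟩
  · rintro rfl
    exact hlt.ne' (numComponents_empty hG)
  · rw [← numComponents_kernImage f, kernImage_sdiff_singleton]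
    exact hcut (f i) fun j hj => f.injective hj ▸ hi

theorem mem_kernImage_image_cutSetsBar [Finite W] (hG : G.Connected) {T : Set W}
    (hT : T ∈ cutSetsBar H) (hrange : (Set.range f)ᶜ ⊆ T) :
    T ∈ Set.kernImage f '' cutSetsBar G := by
  have hkern := Set.kernImage_preimage_eq_iff.2 hrange
  exact ⟨f ⁻¹' T, mem_cutSetsBar_of_kernImage_mem (f := f) hG (by rwa [hkern]), hkern⟩

end Embeddings

section Join

variable {V₁ V₂ : Type*} (G₁ : SimpleGraph V₁) (G₂ : SimpleGraph V₂)

/-- The inclusion of the first factor of a join. -/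
def joinInl : G₁ ↪g join G₁ G₂ := ⟨.inl, Iff.rfl⟩

/-- The inclusion of the second factor of a join. -/
def joinInr : G₂ ↪g join G₁ G₂ := ⟨.inr, Iff.rfl⟩

variable {G₁ G₂}

theorem joinInl_adj (v : V₁) : ∀ w ∉ Set.range (joinInl G₁ G₂), (join G₁ G₂).Adj (joinInl G₁ G₂ v) w
  | .inl u, hu => absurd ⟨u, rfl⟩ hu
  | .inr _, _ => trivial

theorem joinInr_adj (v : V₂) : ∀ w ∉ Set.range (joinInr G₁ G₂), (join G₁ G₂).Adj (joinInr G₁ G₂ v) w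
  | .inl _, _ => trivial
  | .inr u, hu => absurd ⟨u, rfl⟩ hu

theorem compl_range_joinInl : (Set.range (joinInl G₁ G₂))ᶜ = Set.range (joinInr G₁ G₂) :=
  Set.compl_range_inl

theorem compl_range_joinInr : (Set.range (joinInr G₁ G₂))ᶜ = Set.range (joinInl G₁ G₂) :=
  Set.compl_range_inr

theorem numComponents_join_eq_one {T : Set (V₁ ⊕ V₂)} {v : V₁} {w : V₂} (hv : joinInl G₁ G₂ v ∉ T)
    (hw : joinInr G₁ G₂ w ∉ T) : numComponents (join G₁ G₂) T = 1 :=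
  numComponents_eq_one_of_adj joinInl_adj hv (compl_range_joinInl.ge ⟨w, rfl⟩) hw

theorem numComponents_join_empty [Nonempty V₁] [Nonempty V₂] :
    numComponents (join G₁ G₂) ∅ = 1 :=
  numComponents_join_eq_one (Set.notMem_empty (joinInl G₁ G₂ (Classical.arbitrary V₁)))
    (Set.notMem_empty (joinInr G₁ G₂ (Classical.arbitrary V₂)))

theorem cutSetsBar_join [Finite V₁] [Finite V₂] (h₁ : G₁.Connected) (h₂ : G₂.Connected) :
    cutSetsBar (join G₁ G₂) = Set.kernImage (joinInl G₁ G₂) '' cutSetsBar G₁ ∪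
      Set.kernImage (joinInr G₁ G₂) '' cutSetsBar G₂ := by
  refine Set.Subset.antisymm (fun T hT => ?_) (Set.union_subset ?_ ?_)
  · by_cases hr : Set.range (joinInr G₁ G₂) ⊆ T
    · exact Or.inl (mem_kernImage_image_cutSetsBar h₁ hT (compl_range_joinInl.trans_subset hr))
    by_cases hl : Set.range (joinInl G₁ G₂) ⊆ T
    · exact Or.inr (mem_kernImage_image_cutSetsBar h₂ hT (compl_range_joinInr.trans_subset hl))
    obtain ⟨_, ⟨w, rfl⟩, hw⟩ := Set.not_subset.1 hr
    obtain ⟨_, ⟨v, rfl⟩, hv⟩ := Set.not_subset.1 hl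
    exact absurd (numComponents_join_eq_one hv hw) (one_lt_numComponents_of_mem_cutSetsBar hT).ne'
  · exact Set.image_subset_iff.2 fun A hA => kernImage_mem_cutSetsBar joinInl_adj hA
  · exact Set.image_subset_iff.2 fun A hA => kernImage_mem_cutSetsBar joinInr_adj hA

theorem familyJoin_image_inl (𝒜 : Set (Set V₁)) :
    familyJoin (Set.image Sum.inl '' 𝒜) {Set.range Sum.inr} =
      Set.kernImage (joinInl G₁ G₂) '' 𝒜 := by
  simp only [familyJoin, Set.image2_singleton_right, Set.image_image,
    kernImage_eq_image_union (joinInl G₁ G₂).injective, compl_range_joinInl]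
  rfl

theorem familyJoin_image_inr (𝒜 : Set (Set V₂)) :
    familyJoin (Set.image Sum.inr '' 𝒜) {Set.range Sum.inl} =
      Set.kernImage (joinInr G₁ G₂) '' 𝒜 := by
  simp only [familyJoin, Set.image2_singleton_right, Set.image_image,
    kernImage_eq_image_union (joinInr G₁ G₂).injective, compl_range_joinInr]
  rfl

theorem image_cutSets_join [Finite V₁] [Finite V₂] (h₁ : G₁.Connected) (h₂ : G₂.Connected)
    {β : Type*} (g : Set (V₁ ⊕ V₂) → β) : g '' cutSets (join G₁ G₂) =
      {b | ∃ T ∈ cutSetsBar G₁, b = g (Set.kernImage (joinInl G₁ G₂) T)} ∪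
        {b | ∃ T ∈ cutSetsBar G₂, b = g (Set.kernImage (joinInr G₁ G₂) T)} ∪ {g ∅} := by
  rw [cutSets_eq, cutSetsBar_join h₁ h₂, Set.union_comm, Set.image_union, Set.image_union,
    Set.image_image, Set.image_image, Set.image_singleton]
  simp only [Set.image, eq_comm]

variable (K : Type*) [Field K] [Finite V₁] [Finite V₂]

theorem height_primeIdeal_kernImage_joinInl (T : Set V₁) :
    (primeIdeal K (join G₁ G₂) (Set.kernImage (joinInl G₁ G₂) T)).height =
      (primeIdeal K G₁ T).height + 2 * (Nat.card V₂ : ℕ∞) := by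
  rw [height_primeIdeal_kernImage, compl_range_joinInl,
    Set.ncard_range_of_injective (joinInr G₁ G₂).injective]

theorem height_primeIdeal_kernImage_joinInr (T : Set V₂) :
    (primeIdeal K (join G₁ G₂) (Set.kernImage (joinInr G₁ G₂) T)).height =
      (primeIdeal K G₂ T).height + 2 * (Nat.card V₁ : ℕ∞) := by
  rw [height_primeIdeal_kernImage, compl_range_joinInr,
    Set.ncard_range_of_injective (joinInl G₁ G₂).injective]

variable [Nonempty V₁] [Nonempty V₂]

theorem height_primeIdeal_join_empty : (primeIdeal K (join G₁ G₂) ∅).height =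
    (Nat.card V₁ + Nat.card V₂ - 1 : ℕ) := by
  rw [height_primeIdeal, numComponents_join_empty, Set.ncard_empty, zero_add, Nat.card_sum]

theorem ringKrullDim_quotient_primeIdeal_join_empty :
    ringKrullDim (PolyRing K (V₁ ⊕ V₂) ⧸ primeIdeal K (join G₁ G₂) ∅) =
      (Nat.card V₁ + Nat.card V₂ + 1 : ℕ) := by
  rw [ringKrullDim_quotient_primeIdeal, numComponents_join_empty, Set.compl_empty,
    Set.ncard_univ, Nat.card_sum]

end Join

end BinomialEdge

theorem proposition4p1 (K : Type*) [Field K] {V₁ V₂ : Type*} [Fintype V₁] [Fintype V₂]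
    (G₁ : SimpleGraph V₁) (G₂ : SimpleGraph V₂) (h₁ : G₁.Connected) (h₂ : G₂.Connected) :
    (BinomialEdge.cutSets (BinomialEdge.join G₁ G₂) =
      {∅} ∪
      BinomialEdge.familyJoin (Set.image Sum.inl '' BinomialEdge.cutSetsBar G₁) {Set.range Sum.inr} ∪
      BinomialEdge.familyJoin (Set.image Sum.inr '' BinomialEdge.cutSetsBar G₂) {Set.range Sum.inl}) ∧
    IsLeast
      ({h : ℕ∞ | ∃ T₁ ∈ BinomialEdge.cutSetsBar G₁,
          h = (BinomialEdge.primeIdeal K G₁ T₁).height + 2 * (Fintype.card V₂ : ℕ∞)} ∪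
        {h : ℕ∞ | ∃ T₂ ∈ BinomialEdge.cutSetsBar G₂,
          h = (BinomialEdge.primeIdeal K G₂ T₂).height + 2 * (Fintype.card V₁ : ℕ∞)} ∪
        {((Fintype.card V₁ + Fintype.card V₂ - 1 : ℕ) : ℕ∞)})
      (BinomialEdge.edgeIdeal K (BinomialEdge.join G₁ G₂)).height ∧
    IsGreatest
      ({d : WithBot ℕ∞ | ∃ T₁ ∈ BinomialEdge.cutSetsBar G₁,
          d = ringKrullDim (BinomialEdge.PolyRing K V₁ ⧸ BinomialEdge.primeIdeal K G₁ T₁)} ∪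
        {d : WithBot ℕ∞ | ∃ T₂ ∈ BinomialEdge.cutSetsBar G₂,
          d = ringKrullDim (BinomialEdge.PolyRing K V₂ ⧸ BinomialEdge.primeIdeal K G₂ T₂)} ∪
        {((Fintype.card V₁ + Fintype.card V₂ + 1 : ℕ) : WithBot ℕ∞)})
      (ringKrullDim (BinomialEdge.PolyRing K (V₁ ⊕ V₂) ⧸
        BinomialEdge.edgeIdeal K (BinomialEdge.join G₁ G₂))) := by
  have := h₁.nonempty
  have := h₂.nonempty
  have hheight := BinomialEdge.isLeast_height_edgeIdeal K (BinomialEdge.join G₁ G₂)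
  have hdim := BinomialEdge.isGreatest_ringKrullDim_quotient_edgeIdeal K (BinomialEdge.join G₁ G₂)
  simp only [BinomialEdge.image_cutSets_join h₁ h₂,
    BinomialEdge.height_primeIdeal_kernImage_joinInl,
    BinomialEdge.height_primeIdeal_kernImage_joinInr, BinomialEdge.height_primeIdeal_join_empty,
    BinomialEdge.ringKrullDim_quotient_primeIdeal_kernImage,
    BinomialEdge.ringKrullDim_quotient_primeIdeal_join_empty,
    Nat.card_eq_fintype_card] at hheight hdim
  refine ⟨?_, hheight, hdim⟩
  rw [BinomialEdge.cutSets_eq, BinomialEdge.cutSetsBar_join h₁ h₂,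
    BinomialEdge.familyJoin_image_inl, BinomialEdge.familyJoin_image_inr, Set.union_assoc]
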